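/- **Corollary 7.4 (together with Corollary 7.5).** All rings are associative but not necessarily unital, and modules over them are correspondingly nonunital. Let $R$ be a ring and let $\widetilde R=\mathbb Z\oplus R$ be its unitalization, i.e. the unital ring with multiplication $(k,r)(l,s)=(kl,\,ks+lr+rs)$ and unit $(1,0)$, in which $R$ is a two-sided ideal. For a right $R$-module $N$ and a left $R$-module $M$, let $N\otimes_R M$ be the quotient of $N\otimes_{\mathbb Z}M$ by the subgroup generated by the elements $nr\otimes m-n\otimes rm$ with $n\in N$, $r\in R$, $m\in M$. A left $R$-module $M$ is called *t-unital* if the natural map $R\otimes_R M\to M$, $r\otimes m\mapsto rm$, is an isomorphism, and *s-unital* if for every $m\in M$ there is an $e\in R$ with $em=m$. The ring $R$ is called *t-unital* (respectively, *left s-unital*) if $R$ is t-unital (respectively, s-unital) as a left module over itself. A unital right $\widetilde R$-module $N$ is flat if $N\otimes_{\widetilde R}-$ takes injective homomorphisms of unital left $\widetilde R$-modules to injective maps. 1. If $R$ is t-unital, then the full subcategory of t-unital left $R$-modules is closed under kernels in the category of nonunital left $R$-modules if and only if the unital right $\widetilde R$-module $R$ is flat. 2. If $R$ is left s-unital, then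 the unital right $\widetilde R$-module $R$ is flat. -/

import Mathlib

open CategoryTheory MulOpposite
open scoped TensorProduct

universe u v w w'

/-- A (not necessarily unital) left module over an associative, not necessarily unital ring `R`:
an abelian group with a biadditive, associative action of `R`. -/
class NonUnitalModule (R : Type u) (M : Type v) [NonUnitalRing R] [AddCommGroup M]
    extends SMul R M where
  protected smul_add' : ∀ (r : R) (x y : M), r • (x + y) = r • x + r • y
  protected add_smul' : ∀ (r s : R) (x : M), (r + s) • x = r • x + s • x
  protected mul_smul' : ∀ (r s : R) (x : M), (r * s) • x = r • (s • x)

/-- A nonunital ring as a left module over itself. -/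
instance NonUnitalModule.self (R : Type u) [NonUnitalRing R] : NonUnitalModule R R where
  smul_add' := mul_add
  add_smul' := add_mul
  mul_smul' := mul_assoc

section BalancedTensor

/-- The subgroup of `N ⊗[ℤ] M` generated by all `nr ⊗ m - n ⊗ rm`; here `N` carries a right action
of `R` (that is, an action of `Rᵐᵒᵖ`) and `M` a left action of `R`. -/
def balancingSubgroup (R : Type u) (N : Type v) (M : Type w) [AddCommGroup N] [AddCommGroup M]
    [SMul Rᵐᵒᵖ N] [SMul R M] : AddSubgroup (N ⊗[ℤ] M) :=
  AddSubgroup.closure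
    {z | ∃ (n : N) (r : R) (m : M), z = (op r • n) ⊗ₜ[ℤ] m - n ⊗ₜ[ℤ] (r • m)}

/-- The tensor product `N ⊗_R M` of a right and a left module over a noncommutative, possibly
nonunital ring `R`, as an abelian group. -/
abbrev BalancedTensor (R : Type u) (N : Type v) (M : Type w) [AddCommGroup N] [AddCommGroup M]
    [SMul Rᵐᵒᵖ N] [SMul R M] : Type (max v w) :=
  (N ⊗[ℤ] M) ⧸ balancingSubgroup R N M

/-- The pure tensor `n ⊗ m` in `N ⊗_R M`. -/
def BalancedTensor.tmul (R : Type u) {N : Type v} {M : Type w} [AddCommGroup N] [AddCommGroup M]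
    [SMul Rᵐᵒᵖ N] [SMul R M] (n : N) (m : M) : BalancedTensor R N M :=
  QuotientAddGroup.mk (n ⊗ₜ[ℤ] m)

/-- The map `n ⊗ m ↦ n ⊗ f m`, from `N ⊗_R M` to `N ⊗_R M'`, induced by an additive map
`f : M → M'` commuting with the action of `R`. -/
def BalancedTensor.lmap (R : Type u) (N : Type v) {M : Type w} {M' : Type w'} [AddCommGroup N]
    [AddCommGroup M] [AddCommGroup M'] [SMul Rᵐᵒᵖ N] [SMul R M] [SMul R M']
    (f : M →+ M') (hf : ∀ (r : R) (m : M), f (r • m) = r • f m) :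
    BalancedTensor R N M →+ BalancedTensor R N M' :=
  QuotientAddGroup.map _ _ (LinearMap.lTensor N f.toIntLinearMap).toAddMonoidHom <| by
    rw [balancingSubgroup, AddSubgroup.closure_le]
    rintro _ ⟨n, r, m, rfl⟩
    refine AddSubgroup.subset_closure ⟨n, r, f m, ?_⟩
    simp [hf]

theorem BalancedTensor.lmap_tmul (R : Type u) (N : Type v) {M : Type w} {M' : Type w'}
    [AddCommGroup N] [AddCommGroup M] [AddCommGroup M'] [SMul Rᵐᵒᵖ N] [SMul R M] [SMul R M']
    (f : M →+ M') (hf : ∀ (r : R) (m : M), f (r • m) = r • f m) (n : N) (m : M) :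
    BalancedTensor.lmap R N f hf (BalancedTensor.tmul R n m) = BalancedTensor.tmul R n (f m) :=
  rfl

end BalancedTensor

section Unitality

/-- The action of a nonunital ring on a left module, as a biadditive map. -/
def NonUnitalModule.actionHom (R : Type u) (M : Type v) [NonUnitalRing R] [AddCommGroup M]
    [NonUnitalModule R M] : R →+ M →+ M :=
  AddMonoidHom.mk' (fun r ↦ AddMonoidHom.mk' (fun m ↦ r • m) (NonUnitalModule.smul_add' r))
    fun r s ↦ AddMonoidHom.ext fun m ↦ NonUnitalModule.add_smul' r s m

/-- The natural map `r ⊗ m ↦ r m` from `R ⊗_R M` to `M`. -/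
def NonUnitalModule.tensorAction (R : Type u) (M : Type v) [NonUnitalRing R] [AddCommGroup M]
    [NonUnitalModule R M] : BalancedTensor R R M →+ M :=
  QuotientAddGroup.lift _
    (TensorProduct.liftAddHom (R := ℤ) (NonUnitalModule.actionHom R M) fun k r m ↦ by
      rw [map_zsmul, map_zsmul, AddMonoidHom.smul_apply]) <| by
    rw [balancingSubgroup, AddSubgroup.closure_le]
    rintro _ ⟨r, s, m, rfl⟩
    rw [SetLike.mem_coe, AddMonoidHom.mem_ker, map_sub, sub_eq_zero]
    exact NonUnitalModule.mul_smul' r s m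

theorem NonUnitalModule.tensorAction_tmul (R : Type u) (M : Type v) [NonUnitalRing R]
    [AddCommGroup M] [NonUnitalModule R M] (r : R) (m : M) :
    NonUnitalModule.tensorAction R M (BalancedTensor.tmul R r m) = r • m :=
  rfl

/-- A left `R`-module `M` is t-unital if the natural map `R ⊗_R M → M` is an isomorphism. -/
def IsTUnital (R : Type u) (M : Type v) [NonUnitalRing R] [AddCommGroup M]
    [NonUnitalModule R M] : Prop :=
  Function.Bijective (NonUnitalModule.tensorAction R M)

/-- A ring `R` is t-unital if the multiplication map `R ⊗_R R → R` is an isomorphism. -/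
def IsTUnitalRing (R : Type u) [NonUnitalRing R] : Prop :=
  IsTUnital R R

/-- A left `R`-module `M` is s-unital if every `m` in `M` satisfies `e m = m` for some `e` in `R`.
-/
def IsSUnital (R : Type u) (M : Type v) [NonUnitalRing R] [AddCommGroup M]
    [NonUnitalModule R M] : Prop :=
  ∀ m : M, ∃ e : R, e • m = m

/-- A ring `R` is left s-unital if it is s-unital as a left module over itself. -/
def IsLeftSUnitalRing (R : Type u) [NonUnitalRing R] : Prop :=
  IsSUnital R R

end Unitality

section ModuleCategory

/-- The objects of the category of nonunital left modules over a nonunital ring `R`. -/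
structure NonUnitalModuleCat (R : Type u) [NonUnitalRing R] where
  carrier : Type v
  [isAddCommGroup : AddCommGroup carrier]
  [isModule : NonUnitalModule R carrier]

attribute [instance] NonUnitalModuleCat.isAddCommGroup NonUnitalModuleCat.isModule

namespace NonUnitalModuleCat

/-- Morphisms of nonunital left modules: additive maps commuting with the action. -/
@[ext]
structure Hom {R : Type u} [NonUnitalRing R] (M N : NonUnitalModuleCat.{u, v} R) where
  toAddHom : M.carrier →+ N.carrier
  map_smul : ∀ (r : R) (m : M.carrier), toAddHom (r • m) = r • toAddHom m

instance category (R : Type u) [NonUnitalRing R] : Category (NonUnitalModuleCat.{u, v} R) where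
  Hom M N := Hom M N
  id M := ⟨AddMonoidHom.id M.carrier, fun _ _ ↦ rfl⟩
  comp f g := ⟨g.toAddHom.comp f.toAddHom, fun r m ↦ by
    simp only [AddMonoidHom.comp_apply, f.map_smul, g.map_smul]⟩

protected theorem smul_zero {R : Type u} {M : Type v} [NonUnitalRing R] [AddCommGroup M]
    [NonUnitalModule R M] (r : R) : r • (0 : M) = 0 :=
  (NonUnitalModule.actionHom R M r).map_zero

instance hasZeroMorphisms (R : Type u) [NonUnitalRing R] :
    Limits.HasZeroMorphisms (NonUnitalModuleCat.{u, v} R) where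
  zero _ _ := ⟨⟨0, fun r _ ↦ (NonUnitalModuleCat.smul_zero r).symm⟩⟩
  comp_zero _ _ := rfl
  zero_comp _ _ _ f := Hom.ext (AddMonoidHom.ext fun _ ↦ f.toAddHom.map_zero)

/-- The property defining the full subcategory of t-unital modules. -/
def tUnital (R : Type u) [NonUnitalRing R] : ObjectProperty (NonUnitalModuleCat.{u, v} R) :=
  fun M ↦ IsTUnital R M.carrier

end NonUnitalModuleCat

end ModuleCategory

section Flatness

/-- A unital right module `N` over a unital (noncommutative) ring `S` is flat if `N ⊗_S -` takes
injective homomorphisms of unital left `S`-modules to injective maps. The modules tested live in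
the universe `w`; for `w` at least the universe of `S` the notion does not depend on `w`. -/
def IsFlatRightModule (S : Type u) (N : Type v) [Ring S] [AddCommGroup N] [Module Sᵐᵒᵖ N] : Prop :=
  ∀ (K L : Type w) [AddCommGroup K] [AddCommGroup L] [Module S K] [Module S L] (f : K →ₗ[S] L),
    Function.Injective f →
      Function.Injective (BalancedTensor.lmap S N f.toAddMonoidHom f.map_smul)

/-- A nonunital ring `R` as a unital right module over its unitalization `ℤ ⊕ R`, in which `R` is
an ideal: `x (k, r) = k x + x r`. -/
instance unitizationRightModule (R : Type u) [NonUnitalRing R] :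
    Module (Unitization ℤ R)ᵐᵒᵖ R where
  smul a x := (unop a).fst • x + x * (unop a).snd
  one_smul x := by
    change (1 : ℤ) • x + x * 0 = x
    simp
  mul_smul a b x := by
    change ((unop b).fst * (unop a).fst) • x + x * ((unop b).fst • (unop a).snd
        + (unop a).fst • (unop b).snd + (unop b).snd * (unop a).snd)
      = (unop a).fst • ((unop b).fst • x + x * (unop b).snd)
        + ((unop b).fst • x + x * (unop b).snd) * (unop a).snd
    simp only [mul_add, add_mul, smul_add, mul_smul_comm, smul_mul_assoc, mul_assoc, mul_smul]
    rw [smul_comm (unop a).fst (unop b).fst x]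
    abel
  smul_zero a := by
    change (unop a).fst • (0 : R) + 0 * (unop a).snd = 0
    simp
  smul_add a x y := by
    change (unop a).fst • (x + y) + (x + y) * (unop a).snd
      = ((unop a).fst • x + x * (unop a).snd) + ((unop a).fst • y + y * (unop a).snd)
    simp only [smul_add, add_mul]
    abel
  add_smul a b x := by
    change ((unop a).fst + (unop b).fst) • x + x * ((unop a).snd + (unop b).snd)
      = ((unop a).fst • x + x * (unop a).snd) + ((unop b).fst • x + x * (unop b).snd)
    simp only [add_smul, mul_add]
    abel
  zero_smul x := by
    change (0 : ℤ) • x + x * 0 = 0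
    simp

/-- The right action of `ℤ ⊕ R` on `R` is multiplication inside `ℤ ⊕ R`. -/
theorem inr_unitization_smul (R : Type u) [NonUnitalRing R] (a : Unitization ℤ R) (x : R) :
    (Unitization.inr (op a • x) : Unitization ℤ R) = Unitization.inr x * a := by
  change (Unitization.inr (a.fst • x + x * a.snd) : Unitization ℤ R) = _
  refine Unitization.ext ?_ ?_
  · simp only [Unitization.fst_inr, Unitization.fst_mul, zero_mul]
  · simp only [Unitization.snd_inr, Unitization.snd_mul, Unitization.fst_inr, zero_smul, zero_add]

end Flatness

/-! Write `S` for the unitalization. The relations imposed by `S` add nothing to those imposed by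
`R`, so `R ⊗_S M = R ⊗_R M`. If `R` is flat over `S`, then `R ⊗_R -` is exact, and comparing a left
exact sequence with its tensored version makes kernels t-unital (`IsTUnital.of_exact`). Conversely,
the left action on `R ⊗_S M` factors through `z ↦ counit z`, because `r • z = r ⊗ counit z`
(`smul_eq_tmul_counit`). Hence for injective `f` the kernel of `R ⊗ f` is annihilated by `R`. When
`R` is t-unital, so is `R ⊗_S M` (`BalancedTensor.isTUnital`); closure under kernels makes the
kernel t-unital, and a t-unital module annihilated by `R` is zero. When `R` is left s-unital, each
`z` equals `e • z` for some `e`, so the kernel vanishes at once. -/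

open Limits

/-! ### Universal property and right exactness of the tensor product. -/

namespace BalancedTensor

section Basic

variable {R : Type u} {N : Type v} {M : Type w} [AddCommGroup N] [AddCommGroup M]
  [SMul Rᵐᵒᵖ N] [SMul R M]

theorem smul_tmul (n : N) (r : R) (m : M) : tmul R (op r • n) m = tmul R n (r • m) := by
  refine (QuotientAddGroup.eq_iff_sub_mem).2 ?_
  exact AddSubgroup.subset_closure ⟨n, r, m, rfl⟩

theorem tmul_add (n : N) (m m' : M) : tmul R n (m + m') = tmul R n m + tmul R n m' :=
  congrArg (QuotientAddGroup.mk (s := balancingSubgroup R N M)) (TensorProduct.tmul_add n m m')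

theorem add_tmul (n n' : N) (m : M) : tmul R (n + n') m = tmul R n m + tmul R n' m :=
  congrArg (QuotientAddGroup.mk (s := balancingSubgroup R N M)) (TensorProduct.add_tmul n n' m)

variable (R N M) in
/-- The universal balanced biadditive map `N × M → N ⊗_R M`. -/
def mkHom : N →+ M →+ BalancedTensor R N M :=
  AddMonoidHom.mk' (fun n ↦ AddMonoidHom.mk' (fun m ↦ tmul R n m) (tmul_add n))
    fun n n' ↦ AddMonoidHom.ext fun m ↦ add_tmul n n' m

theorem tmul_zero (n : N) : tmul R n (0 : M) = 0 := (mkHom R N M n).map_zero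

@[elab_as_elim]
theorem induction_on {p : BalancedTensor R N M → Prop} (z : BalancedTensor R N M)
    (zero : p 0) (tmul : ∀ n m, p (tmul R n m)) (add : ∀ x y, p x → p y → p (x + y)) : p z := by
  obtain ⟨t, rfl⟩ := QuotientAddGroup.mk_surjective z
  induction t using TensorProduct.induction_on with
  | zero => exact zero
  | tmul n m => exact tmul n m
  | add x y hx hy => exact add _ _ hx hy

theorem addHom_ext {A : Type*} [AddCommGroup A] {f g : BalancedTensor R N M →+ A}
    (h : ∀ n m, f (tmul R n m) = g (tmul R n m)) : f = g := by
  refine AddMonoidHom.ext fun z ↦ ?_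
  induction z using induction_on with
  | zero => simp
  | tmul n m => exact h n m
  | add x y hx hy => simp [hx, hy]

/-- The homomorphism from `N ⊗_R M` induced by a balanced biadditive map. -/
def lift {A : Type*} [AddCommGroup A] (f : N →+ M →+ A)
    (hf : ∀ n (r : R) m, f (op r • n) m = f n (r • m)) : BalancedTensor R N M →+ A :=
  QuotientAddGroup.lift _
    (TensorProduct.liftAddHom (R := ℤ) f fun k n m ↦ by
      rw [map_zsmul, map_zsmul, AddMonoidHom.smul_apply]) <| by
    rw [balancingSubgroup, AddSubgroup.closure_le]
    rintro _ ⟨n, r, m, rfl⟩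
    rw [SetLike.mem_coe, AddMonoidHom.mem_ker, map_sub, sub_eq_zero]
    exact hf n r m

end Basic

/-- Right exactness of `N ⊗_R -`. -/
theorem exists_lmap_eq_of_lmap_eq_zero {R : Type u} {N : Type v} {K : Type*} {M : Type*}
    {P : Type*} [AddCommGroup N] [AddCommGroup K] [AddCommGroup M] [AddCommGroup P]
    [SMul Rᵐᵒᵖ N] [SMul R K] [SMul R M] [SMul R P] (f : K →+ M) (g : M →+ P)
    (hf : ∀ (r : R) x, f (r • x) = r • f x) (hg : ∀ (r : R) x, g (r • x) = r • g x)
    (hfg : Function.Exact f g) (hgs : Function.Surjective g) {z : BalancedTensor R N M}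
    (hz : lmap R N g hg z = 0) : ∃ y, lmap R N f hf y = z := by
  obtain ⟨t, rfl⟩ := QuotientAddGroup.mk_surjective z
  set G := LinearMap.lTensor N g.toIntLinearMap
  have hGt : G t ∈ balancingSubgroup R N P := (QuotientAddGroup.eq_zero_iff _).1 hz
  -- Since `g` is surjective, every balancing relation over `P` lifts to one over `M`; correcting
  -- `t` by such a lift reduces to exactness over `ℤ`.
  have hle : balancingSubgroup R N P ≤ (balancingSubgroup R N M).map G.toAddMonoidHom := by
    rw [balancingSubgroup, AddSubgroup.closure_le]
    rintro _ ⟨n, r, p, rfl⟩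
    obtain ⟨m, rfl⟩ := hgs p
    exact ⟨_, AddSubgroup.subset_closure ⟨n, r, m, rfl⟩, by simp [G, hg]⟩
  obtain ⟨b, hb, hbt⟩ := hle hGt
  have hex := lTensor_exact N (f := f.toIntLinearMap) (g := g.toIntLinearMap) hfg hgs
  obtain ⟨y, hy⟩ := (hex (t - b)).1 (by
    rw [map_sub, sub_eq_zero]
    exact hbt.symm)
  refine ⟨QuotientAddGroup.mk y, QuotientAddGroup.eq_iff_sub_mem.2 ?_⟩
  have : LinearMap.lTensor N f.toIntLinearMap y - t = -b := by rw [hy]; abel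
  change LinearMap.lTensor N f.toIntLinearMap y - t ∈ _
  rw [this]
  exact neg_mem hb

end BalancedTensor

/-! ### Nonunital `R`-modules as unital modules over `ℤ ⊕ R`. -/

section Unitization

variable {R : Type u} [NonUnitalRing R]

theorem op_unitization_smul (a : Unitization ℤ R) (x : R) :
    op a • x = a.fst • x + x * a.snd := rfl

theorem op_inr_smul (r x : R) : op (Unitization.inr r : Unitization ℤ R) • x = x * r := by
  simp [op_unitization_smul]

/-- A nonunital left `R`-module as a unital left module over `ℤ ⊕ R`. -/
abbrev NonUnitalModule.toUnitizationModule (R : Type u) [NonUnitalRing R] (M : Type v)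
    [AddCommGroup M] [NonUnitalModule R M] : Module (Unitization ℤ R) M where
  smul a m := a.fst • m + a.snd • m
  one_smul m := by
    change (1 : ℤ) • m + NonUnitalModule.actionHom R M 0 m = m
    simp
  mul_smul a b m := by
    change (a.fst * b.fst) • m + NonUnitalModule.actionHom R M
        (a.fst • b.snd + b.fst • a.snd + a.snd * b.snd) m
      = a.fst • (b.fst • m + NonUnitalModule.actionHom R M b.snd m)
        + NonUnitalModule.actionHom R M a.snd
          (b.fst • m + NonUnitalModule.actionHom R M b.snd m)
    have h : NonUnitalModule.actionHom R M (a.snd * b.snd) m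
        = NonUnitalModule.actionHom R M a.snd (NonUnitalModule.actionHom R M b.snd m) :=
      NonUnitalModule.mul_smul' _ _ _
    simp only [map_add, map_zsmul, AddMonoidHom.add_apply, AddMonoidHom.smul_apply, h, smul_add,
      mul_smul]
    abel
  smul_zero a := by
    change a.fst • (0 : M) + NonUnitalModule.actionHom R M a.snd 0 = 0
    simp
  smul_add a x y := by
    change a.fst • (x + y) + NonUnitalModule.actionHom R M a.snd (x + y)
      = (a.fst • x + NonUnitalModule.actionHom R M a.snd x)
        + (a.fst • y + NonUnitalModule.actionHom R M a.snd y)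
    simp only [smul_add, map_add]
    abel
  add_smul a b x := by
    change (a.fst + b.fst) • x + NonUnitalModule.actionHom R M (a.snd + b.snd) x
      = (a.fst • x + NonUnitalModule.actionHom R M a.snd x)
        + (b.fst • x + NonUnitalModule.actionHom R M b.snd x)
    simp only [add_smul, map_add, AddMonoidHom.add_apply]
    abel
  zero_smul x := by
    change (0 : ℤ) • x + NonUnitalModule.actionHom R M 0 x = 0
    simp

-- The integer part of a scalar already crosses `⊗[ℤ]`, so the relation for `(k, r)` is the one for
-- `r`.
attribute [local instance] NonUnitalModule.toUnitizationModule in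
theorem balancingSubgroup_unitization (M : Type v) [AddCommGroup M] [NonUnitalModule R M] :
    balancingSubgroup (Unitization ℤ R) R M = balancingSubgroup R R M := by
  have key (a : Unitization ℤ R) (x : R) (m : M) :
      (op a • x) ⊗ₜ[ℤ] m - x ⊗ₜ[ℤ] (a • m)
        = (op a.snd • x) ⊗ₜ[ℤ] m - x ⊗ₜ[ℤ] (a.snd • m) := by
    change (a.fst • x + x * a.snd) ⊗ₜ[ℤ] m - x ⊗ₜ[ℤ] (a.fst • m + a.snd • m) = _
    rw [TensorProduct.add_tmul, TensorProduct.tmul_add, TensorProduct.smul_tmul]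
    exact add_sub_add_left_eq_sub _ _ _
  refine congrArg AddSubgroup.closure (Set.ext fun z ↦ ⟨?_, ?_⟩)
  · rintro ⟨x, a, m, rfl⟩
    exact ⟨x, a.snd, m, key a x m⟩
  · rintro ⟨x, r, m, rfl⟩
    exact ⟨x, Unitization.inr r, m, (key (Unitization.inr r) x m).symm⟩

theorem IsFlatRightModule.lmap_injective {S : Type u} {N : Type v} [Ring S] [AddCommGroup N]
    [Module Sᵐᵒᵖ N] (h : IsFlatRightModule.{u, v, w} S N) {K L : Type w} [AddCommGroup K]
    [AddCommGroup L] [Module S K] [Module S L] (f : K →+ L)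
    (hf : ∀ (a : S) x, f (a • x) = a • f x) (hinj : Function.Injective f) :
    Function.Injective (BalancedTensor.lmap S N f hf) :=
  h K L { f with map_smul' := hf } hinj

attribute [local instance] NonUnitalModule.toUnitizationModule in
/-- If `R` is flat over `ℤ ⊕ R`, then `R ⊗_R -` preserves injections of nonunital modules. -/
theorem IsFlatRightModule.lmap_nonUnital_injective
    (h : IsFlatRightModule.{u, u, w} (Unitization ℤ R) R) {K L : Type w} [AddCommGroup K]
    [AddCommGroup L] [NonUnitalModule R K] [NonUnitalModule R L] (f : K →+ L)
    (hf : ∀ (r : R) x, f (r • x) = r • f x) (hinj : Function.Injective f) :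
    Function.Injective (BalancedTensor.lmap R R f hf) := by
  have hf' (a : Unitization ℤ R) (x : K) : f (a • x) = a • f x := by
    change f (a.fst • x + a.snd • x) = a.fst • f x + a.snd • f x
    rw [map_add, map_zsmul, hf]
  have hF := (injective_iff_map_eq_zero _).1 (h.lmap_injective f hf' hinj)
  refine (injective_iff_map_eq_zero _).2 fun z hz ↦ ?_
  -- The two quotients are by equal subgroups but are distinct types, so vanishing is transferred as
  -- membership of a representative.
  obtain ⟨t, rfl⟩ := QuotientAddGroup.mk_surjective z
  have ht : LinearMap.lTensor R f.toIntLinearMap t ∈ balancingSubgroup R R L :=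
    (QuotientAddGroup.eq_zero_iff _).1 hz
  rw [← balancingSubgroup_unitization] at ht
  refine (QuotientAddGroup.eq_zero_iff _).2 ?_
  rw [← balancingSubgroup_unitization]
  exact (QuotientAddGroup.eq_zero_iff _).1
    (hF (QuotientAddGroup.mk t) ((QuotientAddGroup.eq_zero_iff _).2 ht))

end Unitization

/-! ### Kernels of maps of t-unital modules when `R` is flat. -/

namespace NonUnitalModule

variable {R : Type u} [NonUnitalRing R]

theorem tensorAction_lmap {M M' : Type*} [AddCommGroup M] [AddCommGroup M'] [NonUnitalModule R M]
    [NonUnitalModule R M'] (f : M →+ M') (hf : ∀ (r : R) m, f (r • m) = r • f m)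
    (z : BalancedTensor R R M) :
    tensorAction R M' (BalancedTensor.lmap R R f hf z) = f (tensorAction R M z) := by
  suffices h : (tensorAction R M').comp (BalancedTensor.lmap R R f hf)
      = f.comp (tensorAction R M) from DFunLike.congr_fun h z
  exact BalancedTensor.addHom_ext fun r m ↦ (hf r m).symm

/-- The image of a homomorphism of nonunital modules. -/
abbrev ofRange {M M' : Type*} [AddCommGroup M] [AddCommGroup M'] [NonUnitalModule R M]
    [NonUnitalModule R M'] (f : M →+ M') (hf : ∀ (r : R) m, f (r • m) = r • f m) :
    NonUnitalModule R f.range where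
  smul r y := ⟨r • y.1, by
    obtain ⟨_, x, rfl⟩ := y
    exact ⟨r • x, hf r x⟩⟩
  smul_add' r x y := Subtype.ext (NonUnitalModule.smul_add' r x.1 y.1)
  add_smul' r s x := Subtype.ext (NonUnitalModule.add_smul' r s x.1)
  mul_smul' r s x := Subtype.ext (NonUnitalModule.mul_smul' r s x.1)

/-- The kernel of a homomorphism of nonunital modules. -/
abbrev ofKer {M M' : Type*} [AddCommGroup M] [AddCommGroup M'] [NonUnitalModule R M]
    [NonUnitalModule R M'] (f : M →+ M') (hf : ∀ (r : R) m, f (r • m) = r • f m) :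
    NonUnitalModule R f.ker where
  smul r x := ⟨r • x.1, by
    rw [AddMonoidHom.mem_ker, hf, AddMonoidHom.mem_ker.1 x.2]
    exact NonUnitalModuleCat.smul_zero r⟩
  smul_add' r x y := Subtype.ext (NonUnitalModule.smul_add' r x.1 y.1)
  add_smul' r s x := Subtype.ext (NonUnitalModule.add_smul' r s x.1)
  mul_smul' r s x := Subtype.ext (NonUnitalModule.mul_smul' r s x.1)

end NonUnitalModule

/-- If `R` is flat over `ℤ ⊕ R`, then a kernel of a map between t-unital modules is t-unital. -/
theorem IsTUnital.of_exact {R : Type u} [NonUnitalRing R]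
    (h : IsFlatRightModule.{u, u, w} (Unitization ℤ R) R) {K X Y : Type w} [AddCommGroup K]
    [AddCommGroup X] [AddCommGroup Y] [NonUnitalModule R K] [NonUnitalModule R X]
    [NonUnitalModule R Y] (i : K →+ X) (f : X →+ Y) (hi : ∀ (r : R) x, i (r • x) = r • i x)
    (hf : ∀ (r : R) x, f (r • x) = r • f x) (hinj : Function.Injective i)
    (hex : Function.Exact i f) (hX : IsTUnital R X) (hY : IsTUnital R Y) : IsTUnital R K := by
  refine ⟨(injective_iff_map_eq_zero _).2 fun z hz ↦ ?_, fun k ↦ ?_⟩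
  · apply h.lmap_nonUnital_injective i hi hinj
    apply hX.1
    rw [NonUnitalModule.tensorAction_lmap, hz]
    simp
  · obtain ⟨t, ht⟩ := hX.2 (i k)
    -- Right exactness needs a surjection, so `f` is replaced by its corestriction to the range;
    -- flatness makes `R ⊗ range → R ⊗ Y` injective, so `t` still dies there.
    let := NonUnitalModule.ofRange f hf
    have hf' (r : R) (x : X) : f.rangeRestrict (r • x) = r • f.rangeRestrict x :=
      Subtype.ext (hf r x)
    have hsub (r : R) (y : f.range) : f.range.subtype (r • y) = r • f.range.subtype y := rfl
    have hzero : BalancedTensor.lmap R R f hf t = 0 := by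
      apply hY.1
      rw [NonUnitalModule.tensorAction_lmap, ht, hex.apply_apply_eq_zero, map_zero]
    have hcomp : BalancedTensor.lmap R R f hf t = BalancedTensor.lmap R R f.range.subtype hsub
        (BalancedTensor.lmap R R f.rangeRestrict hf' t) := by
      suffices h : BalancedTensor.lmap R R f hf = (BalancedTensor.lmap R R f.range.subtype hsub).comp
          (BalancedTensor.lmap R R f.rangeRestrict hf') from DFunLike.congr_fun h t
      exact BalancedTensor.addHom_ext fun _ _ ↦ rfl
    have hrange : BalancedTensor.lmap R R f.rangeRestrict hf' t = 0 := by
      apply h.lmap_nonUnital_injective f.range.subtype hsub Subtype.val_injective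
      rw [← hcomp, hzero, map_zero]
    obtain ⟨y, hy⟩ := BalancedTensor.exists_lmap_eq_of_lmap_eq_zero i f.rangeRestrict hi hf'
      (fun x ↦ by rw [← hex x]; exact Subtype.ext_iff) f.rangeRestrict_surjective
      hrange
    refine ⟨y, hinj ?_⟩
    rw [← NonUnitalModule.tensorAction_lmap i hi, hy, ht]

/-! ### The left `R`-module `R ⊗_S M`. -/

/-- A homomorphism of right `S`-modules `ι : R → S` for which `x ι(r) = x r` for all `x`, `r` in `R`,
such as the inclusion of a right ideal. -/
structure IsRightIdealMap {R : Type u} {S : Type v} [NonUnitalRing R] [Ring S] [Module Sᵐᵒᵖ R]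
    (ι : R →+ S) : Prop where
  map_op_smul : ∀ (a : S) (x : R), ι (op a • x) = ι x * a
  op_map_smul : ∀ r x : R, op (ι r) • x = x * r

theorem IsRightIdealMap.unitization (R : Type u) [NonUnitalRing R] :
    IsRightIdealMap (S := Unitization ℤ R)
      (AddMonoidHom.mk' (fun r : R ↦ (Unitization.inr r : Unitization ℤ R))
        (Unitization.inr_add ℤ)) :=
  ⟨inr_unitization_smul R, op_inr_smul⟩

instance smulCommClass_unitization (R : Type u) [NonUnitalRing R] :
    SMulCommClass R (Unitization ℤ R)ᵐᵒᵖ R where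
  smul_comm r a x := by
    change r * ((unop a).fst • x + x * (unop a).snd) = (unop a).fst • (r * x) + r * x * (unop a).snd
    rw [mul_add, mul_smul_comm, mul_assoc]

namespace BalancedTensor

variable {R : Type u} {S : Type w} [NonUnitalRing R] [Ring S] [Module Sᵐᵒᵖ R]
  {M : Type v} [AddCommGroup M] [Module S M]

/-- The natural map `r ⊗ m ↦ ι(r) m` from `R ⊗_S M` to `M`. -/
def counit {ι : R →+ S} (hι : IsRightIdealMap ι) (M : Type v) [AddCommGroup M] [Module S M] :
    BalancedTensor S R M →+ M :=
  lift ((Module.toAddMonoidEnd S M).toAddMonoidHom.comp ι) fun x a m ↦ by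
    change ι (op a • x) • m = ι x • a • m
    rw [hι.map_op_smul, mul_smul]

theorem counit_tmul {ι : R →+ S} (hι : IsRightIdealMap ι) (r : R) (m : M) :
    counit hι M (tmul S r m) = ι r • m := rfl

theorem counit_lmap {ι : R →+ S} (hι : IsRightIdealMap ι) {L : Type*} [AddCommGroup L]
    [Module S L] (f : M →+ L) (hf : ∀ (a : S) m, f (a • m) = a • f m)
    (z : BalancedTensor S R M) : counit hι L (lmap S R f hf z) = f (counit hι M z) := by
  suffices h : (counit hι L).comp (lmap S R f hf) = f.comp (counit hι M) from
    DFunLike.congr_fun h z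
  exact addHom_ext fun r m ↦ (hf _ m).symm

variable [SMulCommClass R Sᵐᵒᵖ R]

/-- Left multiplication by an element of `R` on `R ⊗_S M`. -/
def mulLeft (S : Type w) [Ring S] [Module Sᵐᵒᵖ R] [SMulCommClass R Sᵐᵒᵖ R] (M : Type v)
    [AddCommGroup M] [Module S M] (r : R) : BalancedTensor S R M →+ BalancedTensor S R M :=
  lift ((mkHom S R M).comp (AddMonoidHom.mulLeft r)) fun x a m ↦ by
    change tmul S (r • op a • x) m = tmul S (r • x) (a • m)
    rw [← smul_tmul, smul_comm]

/-- The left action of `R` on `R ⊗_S M`, given by `r (s ⊗ m) = rs ⊗ m`. -/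
instance leftModule : NonUnitalModule R (BalancedTensor S R M) where
  smul r := mulLeft S M r
  smul_add' r x y := map_add (mulLeft S M r) x y
  add_smul' r s z := by
    suffices h : mulLeft S M (r + s) = mulLeft S M r + mulLeft S M s from DFunLike.congr_fun h z
    refine addHom_ext fun x m ↦ ?_
    change tmul S ((r + s) * x) m = tmul S (r * x) m + tmul S (s * x) m
    rw [add_mul, add_tmul]
  mul_smul' r s z := by
    suffices h : mulLeft S M (r * s) = (mulLeft S M r).comp (mulLeft S M s) from
      DFunLike.congr_fun h z
    exact addHom_ext fun x m ↦ congrArg (tmul S · m) (mul_assoc r s x)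

theorem smul_left_tmul (r x : R) (m : M) : r • tmul S x m = tmul S (r * x) m := rfl

/-- On pure tensors, `rx ⊗ m = r ⊗ ι(x) m`, as right multiplication by `x` is the action of `ι(x)`.
-/
theorem smul_eq_tmul_counit {ι : R →+ S} (hι : IsRightIdealMap ι) (r : R)
    (z : BalancedTensor S R M) : r • z = tmul S r (counit hι M z) := by
  induction z using induction_on with
  | zero => rw [map_zero, tmul_zero, NonUnitalModuleCat.smul_zero]
  | tmul x m => rw [smul_left_tmul, counit_tmul, ← smul_tmul, hι.op_map_smul]
  | add x y hx hy => rw [NonUnitalModule.smul_add', hx, hy, map_add, tmul_add]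

/-- An element killed by `R ⊗ f`, with `f` injective, is annihilated by `R`. -/
theorem smul_eq_zero_of_lmap_eq_zero {ι : R →+ S} (hι : IsRightIdealMap ι) {L : Type*}
    [AddCommGroup L] [Module S L] {f : M →+ L} {hf : ∀ (a : S) m, f (a • m) = a • f m}
    (hinj : Function.Injective f) {z : BalancedTensor S R M} (hz : lmap S R f hf z = 0) (r : R) :
    r • z = 0 := by
  have : counit hι M z = 0 := hinj <| by rw [← counit_lmap hι f hf, hz, map_zero, map_zero]
  rw [smul_eq_tmul_counit hι, this, tmul_zero]

theorem lmap_smul {L : Type*} [AddCommGroup L] [Module S L] (f : M →+ L)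
    (hf : ∀ (a : S) m, f (a • m) = a • f m) (r : R) (z : BalancedTensor S R M) :
    lmap S R f hf (r • z) = r • lmap S R f hf z := by
  suffices h : (lmap S R f hf).comp (mulLeft S M r) = (mulLeft S L r).comp (lmap S R f hf) from
    DFunLike.congr_fun h z
  exact addHom_ext fun _ _ ↦ rfl

/-- If `R` is t-unital, then `R ⊗_S M` is a t-unital left `R`-module. -/
theorem isTUnital (hR : IsTUnitalRing R) : IsTUnital R (BalancedTensor S R M) := by
  let e : BalancedTensor R R R ≃+ R :=
    AddEquiv.ofBijective (NonUnitalModule.tensorAction R R) hR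
  have he (r s : R) : e.symm (r * s) = tmul R r s := e.symm_apply_eq.2 rfl
  let B := BalancedTensor S R M
  let j (m : M) : R →+ B := (mkHom S R M).flip m
  have hj (m : M) (r s : R) : j m (r • s) = r • j m s := rfl
  -- The candidate inverse sends `rs ⊗ m` to `r ⊗ (s ⊗ m)`; it is well defined because `R ⊗_R R ≅
  -- R`.
  let ψ₀ : M →+ R →+ BalancedTensor R R B :=
    AddMonoidHom.mk' (fun m ↦ (lmap R R (j m) (hj m)).comp e.symm.toAddMonoidHom) fun m m' ↦ by
      suffices h : lmap R R (j (m + m')) (hj _) = lmap R R (j m) (hj _) + lmap R R (j m') (hj _) by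
        rw [h]; rfl
      refine addHom_ext fun r s ↦ ?_
      change tmul R r (tmul S s (m + m')) =
        tmul R r (tmul S s m) + tmul R r (tmul S s m')
      rw [tmul_add, tmul_add]
  have hψ₀ (r s : R) (m : M) :
      ψ₀ m (r * s) = tmul R r (tmul S s m) := by
    change lmap R R (j m) (hj m) (e.symm (r * s)) = _
    rw [he]
    rfl
  have hbal (x : R) (a : S) (m : M) : ψ₀ m (op a • x) = ψ₀ (a • m) x := by
    -- Every `x` is a sum of products `r * s`, and on a product the scalar `a` acts on the right
    -- factor alone.
    obtain ⟨t, rfl⟩ := e.surjective x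
    induction t using induction_on with
    | zero => simp
    | tmul r s =>
      change ψ₀ m (op a • (r * s)) = ψ₀ (a • m) (r * s)
      have : op a • (r * s) = r * op a • s := by
        exact (smul_comm r (op a) s).symm
      rw [this, hψ₀, hψ₀, smul_tmul]
    | add x y hx hy => rw [map_add, smul_add, map_add, map_add, hx, hy]
  let ψ : B →+ BalancedTensor R R B := lift ψ₀.flip hbal
  have hψ : ψ.comp (NonUnitalModule.tensorAction R B) = AddMonoidHom.id _ := by
    refine addHom_ext fun r z ↦ ?_
    change ψ (r • z) = tmul R r z
    induction z using induction_on with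
    | zero => rw [NonUnitalModuleCat.smul_zero, map_zero, tmul_zero]
    | tmul s m => exact hψ₀ r s m
    | add x y hx hy => rw [NonUnitalModule.smul_add', map_add, hx, hy, tmul_add]
  refine ⟨Function.LeftInverse.injective (g := ψ) (DFunLike.congr_fun hψ), fun z ↦ ?_⟩
  induction z using induction_on with
  | zero => exact ⟨0, map_zero _⟩
  | tmul x m =>
    obtain ⟨t, rfl⟩ := e.surjective x
    exact ⟨lmap R R (j m) (hj m) t, NonUnitalModule.tensorAction_lmap _ _ t⟩
  | add x y hx hy =>
    obtain ⟨x', rfl⟩ := hx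
    obtain ⟨y', rfl⟩ := hy
    exact ⟨x' + y', map_add _ _ _⟩

end BalancedTensor

/-- The action map is surjective, yet zero on pure tensors. -/
theorem IsTUnital.eq_zero_of_smul_eq_zero {R : Type u} {M : Type v} [NonUnitalRing R]
    [AddCommGroup M] [NonUnitalModule R M] (hM : IsTUnital R M)
    (h : ∀ (r : R) (m : M), r • m = 0) (m : M) : m = 0 := by
  obtain ⟨z, rfl⟩ := hM.2 m
  exact DFunLike.congr_fun (f := NonUnitalModule.tensorAction R M) (g := 0)
    (BalancedTensor.addHom_ext h) z

/-! ### Left s-unital rings. -/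

namespace IsLeftSUnitalRing

variable {R : Type u} [NonUnitalRing R]

/-- In a left s-unital ring, finitely many elements have a common left unit. -/
theorem exists_common_unit (hR : IsLeftSUnitalRing R) (s : Finset R) :
    ∃ e : R, ∀ x ∈ s, e * x = x := by
  classical
  induction s using Finset.induction_on with
  | empty => exact ⟨0, by simp⟩
  | insert y s _ ih =>
    obtain ⟨e, he⟩ := ih
    obtain ⟨d, hd⟩ : ∃ d : R, d * (y - e * y) = y - e * y := hR (y - e * y)
    -- Formally `1 - (e + d - de) = (1 - d)(1 - e)`: the factor `1 - e` kills `s`, and `1 - d` kills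
    -- `(1 - e) y`.
    refine ⟨e + d - d * e, fun x hx ↦ ?_⟩
    rw [sub_mul, add_mul, mul_assoc]
    obtain rfl | hx := Finset.mem_insert.1 hx
    · rw [add_sub_assoc, ← mul_sub, hd]
      abel
    · rw [he x hx]
      abel

theorem exists_smul_eq (hR : IsLeftSUnitalRing R) {S : Type w} [Ring S] [Module Sᵐᵒᵖ R]
    [SMulCommClass R Sᵐᵒᵖ R] {M : Type v} [AddCommGroup M] [Module S M]
    (z : BalancedTensor S R M) :
    ∃ e : R, e • z = z := by
  classical
  -- Units of two summands may differ, so the induction collects the left factors to be fixed and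
  -- chooses `e` only afterwards.
  obtain ⟨s, hs⟩ : ∃ s : Finset R, ∀ e : R, (∀ x ∈ s, e * x = x) → e • z = z := by
    induction z using BalancedTensor.induction_on with
    | zero => exact ⟨∅, fun e _ ↦ NonUnitalModuleCat.smul_zero e⟩
    | tmul x m =>
      refine ⟨{x}, fun e he ↦ ?_⟩
      rw [BalancedTensor.smul_left_tmul, he x (Finset.mem_singleton_self x)]
    | add x y hx hy =>
      obtain ⟨s, hs⟩ := hx
      obtain ⟨t, ht⟩ := hy
      refine ⟨s ∪ t, fun e he ↦ ?_⟩
      rw [NonUnitalModule.smul_add', hs e fun x hx ↦ he x (Finset.mem_union_left _ hx),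
        ht e fun x hx ↦ he x (Finset.mem_union_right _ hx)]
  obtain ⟨e, he⟩ := hR.exists_common_unit s
  exact ⟨e, hs e he⟩

theorem isFlatRightModule (hR : IsLeftSUnitalRing R) {S : Type v} [Ring S] [Module Sᵐᵒᵖ R]
    [SMulCommClass R Sᵐᵒᵖ R] {ι : R →+ S} (hι : IsRightIdealMap ι) :
    IsFlatRightModule.{v, u, w} S R := by
  intro K L _ _ _ _ f hf
  refine (injective_iff_map_eq_zero _).2 fun z hz ↦ ?_
  obtain ⟨e, he⟩ := hR.exists_smul_eq z
  rw [← he, BalancedTensor.smul_eq_zero_of_lmap_eq_zero hι hf hz]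

end IsLeftSUnitalRing

/-! ### Kernels in the category of nonunital modules. -/

namespace NonUnitalModuleCat

variable {R : Type u} [NonUnitalRing R] {X Y : NonUnitalModuleCat.{u, v} R}

/-- The kernel of a morphism of nonunital modules. -/
def ker (f : X ⟶ Y) : NonUnitalModuleCat.{u, v} R :=
  letI := NonUnitalModule.ofKer f.toAddHom f.map_smul
  ⟨f.toAddHom.ker⟩

/-- The inclusion of the kernel of a morphism of nonunital modules. -/
def kerι (f : X ⟶ Y) : ker f ⟶ X := ⟨f.toAddHom.ker.subtype, fun _ _ ↦ rfl⟩

theorem kerι_comp (f : X ⟶ Y) : kerι f ≫ f = 0 :=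
  Hom.ext (AddMonoidHom.ext fun x ↦ x.2)

theorem kerι_injective (f : X ⟶ Y) : Function.Injective (kerι f).toAddHom :=
  Subtype.val_injective

/-- The factorization through the kernel of a morphism annihilated by `f`. -/
def kerLift (f : X ⟶ Y) {Z : NonUnitalModuleCat.{u, v} R} (g : Z ⟶ X) (h : g ≫ f = 0) :
    Z ⟶ ker f :=
  ⟨g.toAddHom.codRestrict f.toAddHom.ker fun z ↦
      DFunLike.congr_fun (congrArg Hom.toAddHom h) z,
    fun r z ↦ Subtype.ext (g.map_smul r z)⟩

theorem kerLift_kerι (f : X ⟶ Y) {Z : NonUnitalModuleCat.{u, v} R} (g : Z ⟶ X)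
    (h : g ≫ f = 0) : kerLift f g h ≫ kerι f = g := rfl

/-- The set-theoretic kernel is a kernel in the category of nonunital modules. -/
def kerIsLimit (f : X ⟶ Y) : IsLimit (KernelFork.ofι (kerι f) (kerι_comp f)) :=
  KernelFork.IsLimit.ofι _ _ (kerLift f) (kerLift_kerι f) fun _ _ _ hm ↦
    Hom.ext (AddMonoidHom.ext fun x ↦ kerι_injective f
      (DFunLike.congr_fun (congrArg Hom.toAddHom hm) x))

/-- Closure under kernels concerns arbitrary limit forks; comparison with the set-theoretic kernel
gives access to elements. -/
theorem injective_of_isLimit {f : X ⟶ Y} {k : KernelFork f} (hk : IsLimit k) :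
    Function.Injective k.ι.toAddHom := by
  obtain ⟨l, hl⟩ := KernelFork.IsLimit.lift' hk (kerι f) (kerι_comp f)
  have h : kerLift f k.ι k.condition ≫ l = 𝟙 k.pt := by
    apply Fork.IsLimit.hom_ext hk
    rw [Category.assoc, hl, kerLift_kerι, Category.id_comp]
  have hinj : Function.Injective (kerLift f k.ι k.condition).toAddHom :=
    Function.LeftInverse.injective (g := l.toAddHom) fun x ↦
      DFunLike.congr_fun (congrArg Hom.toAddHom h) x
  exact (kerι_injective f).comp hinj

theorem exact_of_isLimit {f : X ⟶ Y} {k : KernelFork f} (hk : IsLimit k) :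
    Function.Exact k.ι.toAddHom f.toAddHom := by
  obtain ⟨l, hl⟩ := KernelFork.IsLimit.lift' hk (kerι f) (kerι_comp f)
  refine fun x ↦ ⟨fun hx ↦ ⟨l.toAddHom ⟨x, hx⟩, ?_⟩, ?_⟩
  · exact DFunLike.congr_fun (congrArg Hom.toAddHom hl) ⟨x, hx⟩
  · rintro ⟨z, rfl⟩
    exact DFunLike.congr_fun (congrArg Hom.toAddHom k.condition) z

end NonUnitalModuleCat

/-! ### Closure under kernels versus flatness. -/

namespace IsTUnitalRing

variable {R : Type u} [NonUnitalRing R]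

theorem isFlatRightModule (hR : IsTUnitalRing R) {S : Type w} [Ring S] [Module Sᵐᵒᵖ R]
    [SMulCommClass R Sᵐᵒᵖ R] {ι : R →+ S} (hι : IsRightIdealMap ι)
    (h : (NonUnitalModuleCat.tUnital.{u, max u v} R).IsClosedUnderKernels) :
    IsFlatRightModule.{w, u, max u v} S R := by
  intro K L _ _ _ _ f hf
  -- The universe `max u v` absorbs that of `R`, so `R ⊗_S K` stays in the universe of `K`.
  let X : NonUnitalModuleCat.{u, max u v} R := ⟨BalancedTensor S R K⟩
  let Y : NonUnitalModuleCat.{u, max u v} R := ⟨BalancedTensor S R L⟩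
  let F : X ⟶ Y := ⟨BalancedTensor.lmap S R f.toAddMonoidHom f.map_smul,
    BalancedTensor.lmap_smul f.toAddMonoidHom f.map_smul⟩
  have hker : IsTUnital R (NonUnitalModuleCat.ker F).carrier :=
    ObjectProperty.prop_of_isLimit_kernelFork (P := NonUnitalModuleCat.tUnital.{u, max u v} R)
      (NonUnitalModuleCat.kerIsLimit F) (BalancedTensor.isTUnital hR)
      (BalancedTensor.isTUnital hR)
  refine (injective_iff_map_eq_zero _).2 fun z hz ↦ ?_
  exact congrArg Subtype.val (hker.eq_zero_of_smul_eq_zero (fun r x ↦ Subtype.ext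
    (BalancedTensor.smul_eq_zero_of_lmap_eq_zero (hf := f.map_smul) hι hf x.2 r)) ⟨z, hz⟩)

end IsTUnitalRing

theorem IsFlatRightModule.isClosedUnderKernels {R : Type u} [NonUnitalRing R]
    (h : IsFlatRightModule.{u, u, w} (Unitization ℤ R) R) :
    (NonUnitalModuleCat.tUnital.{u, w} R).IsClosedUnderKernels where
  kernels_le := by
    rintro _ ⟨f, k, hk, hX, hY⟩
    exact IsTUnital.of_exact h k.ι.toAddHom f.toAddHom k.ι.map_smul f.map_smul
      (NonUnitalModuleCat.injective_of_isLimit hk) (NonUnitalModuleCat.exact_of_isLimit hk) hX hY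

theorem corollary7p4 (R : Type u) [NonUnitalRing R] :
    (IsTUnitalRing R →
      ((NonUnitalModuleCat.tUnital.{u, max u v} R).IsClosedUnderKernels ↔
        IsFlatRightModule.{u, u, max u v} (Unitization ℤ R) R)) ∧
    (IsLeftSUnitalRing R → IsFlatRightModule.{u, u, max u v} (Unitization ℤ R) R) := by
  exact ⟨fun hR ↦ ⟨IsTUnitalRing.isFlatRightModule.{u, v} hR (.unitization R),
    IsFlatRightModule.isClosedUnderKernels⟩,
    fun hR ↦ IsLeftSUnitalRing.isFlatRightModule hR (.unitization R)⟩
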